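/- Let $q$ be an odd prime power and let $Sp_n(q)$ be the symplectic group of the $2n$-dimensional symplectic space over $\mathbb F_q$ with hyperbolic basis $e_1,f_1,\dots,e_n,f_n$. For $m\le n$ the group $Sp_m(q)$ is embedded in $Sp_n(q)$ by $U\mapsto \mathrm{diag}(U,I_{2n-2m})$ (acting as $U$ on the span of $e_i,f_i$, $i\le m$, and as the identity on the span of the other $e_i,f_i$), and $Sp_\infty(q)$ is the direct limit of these groups. For a monic $f$ of degree $d$ with $f(0)\neq 0$ let $\bar f(t)=f(0)^{-1}t^{d}f(1/t)$, and let $\Phi^s$ be the set of monic self-dual ($\bar f=f$) polynomials $f\in\mathbb F_q[t]$ with $f(0)\ne0$ that are irreducible or of the form $f=g\bar g$ with $g$ monic irreducible, $g\neq\bar g$. The symplectic type of $U\in Sp_n(q)$ is the triple $(\boldsymbol\lambda,h^+,h^-)$ in which: $\boldsymbol\lambda$ assigns to each $f\in\Phi^s$ a partition $\boldsymbol\lambda(f)$ such that $\mathbb F_q^{2n}$, as an $\mathbb F_q[t]$-module with $t$ acting as $U$, is isomorphic to $\bigoplus_{f\in\Phi^s}\bigoplus_i \mathbb F_q[t]/(f^{\boldsymbol\lambda(f)_i})$;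 and $h^{-}$ (resp. $h^+$) assigns to each part $i$ of $\boldsymbol\lambda(t-1)$ (resp. $\boldsymbol\lambda(t+1)$) the sign $-1$ if $i$ is odd, and, if $i$ is even, the class in $\mathbb F_q^\times/(\mathbb F_q^\times)^2=\{\pm1\}$ of the discriminant of the Wall form $h_i(\bar v,\bar w)=Q((U-U^{-1})^{i-1}v,w)$ on $\ker(U-\varepsilon)^i/\big(\ker(U-\varepsilon)^{i-1}+(U-\varepsilon)\ker(U-\varepsilon)^{i+1}\big)$ with $\varepsilon=1$ (resp. $\varepsilon=-1$). The modified symplectic type of $U$ is obtained from its symplectic type by lowering every part of $\boldsymbol\lambda(t-1)$ by one (parts equal to $1$ are deleted), the remaining parts keeping their signs. The completion $\overline{\boldsymbol\lambda}$ of a modified type raises every part of $\boldsymbol\lambda(t-1)$ by one, keeping signs. The weight is $\|\boldsymbol\lambda\|=\sum_{f\in\Phi^s}\deg(f)\,|\boldsymbol\lambda(f)|$. **Proposition (Normal Form Theorem).** (1) Let $U_1,U_2\in Sp_n(q)$ and let $\boldsymbol\lambda,\boldsymbol\mu,\boldsymbol\eta$ be the modified symplectic types of $U_1$, $U_2$,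 $U_1U_2$. Suppose that $\|\boldsymbol\eta\|=\|\boldsymbol\lambda\|+\|\boldsymbol\mu\|$ and $\|\overline{\boldsymbol\eta}\|=2m$. Then $m\le n$, and there are $T\in Sp_n(q)$ and $\overline{U_1},\overline{U_2}\in Sp_m(q)$ such that $$TU_1T^{-1}=\begin{bmatrix}\overline{U_1}&0\\0&I_{2n-2m}\end{bmatrix},\quad TU_2T^{-1}=\begin{bmatrix}\overline{U_2}&0\\0&I_{2n-2m}\end{bmatrix},\quad TU_1U_2T^{-1}=\begin{bmatrix}\overline{U_1}\,\overline{U_2}&0\\0&I_{2n-2m}\end{bmatrix}.$$ (2) For all modified symplectic types $\boldsymbol\lambda,\boldsymbol\mu,\boldsymbol\eta$, let $Z$ be the set of pairs $(U_1,U_2)\in Sp_\infty(q)^2$ such that $U_1$, $U_2$, $U_1U_2$ have modified symplectic types $\boldsymbol\lambda,\boldsymbol\mu,\boldsymbol\eta$ respectively. Then $Z$ meets only finitely many orbits of the action $T\cdot(U_1,U_2)=(TU_1T^{-1},TU_2T^{-1})$ of $Sp_\infty(q)$. -/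

import Mathlib

open Polynomial
open scoped DirectSum

noncomputable section

namespace SymplecticNormalForm

/-! ### Partitions, as finite multisets of positive integers -/

/-- Weight of a partition: the sum of its parts. -/
def weight (p : Multiset ℕ) : ℕ := p.sum

/-- Modification of a partition: every part is lowered by one (parts equal to one disappear). -/
def modify (p : Multiset ℕ) : Multiset ℕ := (p.filter (1 < ·)).map (· - 1)

/-- Completion of a partition: every part is raised by one. -/
def complete (p : Multiset ℕ) : Multiset ℕ := p.map (· + 1)

/-- A signed partition `(λ, h)`: a partition with a sign for every part, equal parts having equal
signs. It is given as the multiset of the pairs `(λ_i, h_i)`. -/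
structure SignedPartition where
  parts : Multiset (ℕ × ℤˣ)
  pos : ∀ x ∈ parts, 0 < x.1
  consistent : ∀ x ∈ parts, ∀ y ∈ parts, x.1 = y.1 → x.2 = y.2

namespace SignedPartition

/-- The underlying partition. -/
def underlying (p : SignedPartition) : Multiset ℕ := p.parts.map Prod.fst

/-- A signed partition is symplectic if every odd part has even multiplicity and sign `-1`. -/
def IsSymplectic (p : SignedPartition) : Prop :=
  (∀ i, Odd i → Even (p.underlying.count i)) ∧ ∀ x ∈ p.parts, Odd x.1 → x.2 = -1

/-- `(1^(m₁,ε₁), 2^(m₂,ε₂), …, r^(mᵣ,εᵣ)) ↦ (1^(m₂,ε₂), …, (r-1)^(mᵣ,εᵣ))`. -/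
def modification (p : SignedPartition) : SignedPartition where
  parts := (p.parts.filter (fun x => 1 < x.1)).map (fun x => (x.1 - 1, x.2))
  pos := by
    intro x hx
    obtain ⟨y, hy, rfl⟩ := Multiset.mem_map.1 hx
    have := (Multiset.mem_filter.1 hy).2
    simp only
    omega
  consistent := by
    intro x hx x' hx' h
    obtain ⟨y, hy, rfl⟩ := Multiset.mem_map.1 hx
    obtain ⟨y', hy', rfl⟩ := Multiset.mem_map.1 hx'
    rw [Multiset.mem_filter] at hy hy'
    exact p.consistent y hy.1 y' hy'.1 (by simp only at h; omega)

/-- `(1^(m₁,ε₁), …, r^(mᵣ,εᵣ)) ↦ (2^(m₁,ε₁), …, (r+1)^(mᵣ,εᵣ))`. -/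
def completion (p : SignedPartition) : SignedPartition where
  parts := p.parts.map (fun x => (x.1 + 1, x.2))
  pos := by
    intro x hx
    obtain ⟨y, _, rfl⟩ := Multiset.mem_map.1 hx
    exact Nat.succ_pos _
  consistent := by
    intro x hx x' hx' h
    obtain ⟨y, hy, rfl⟩ := Multiset.mem_map.1 hx
    obtain ⟨y', hy', rfl⟩ := Multiset.mem_map.1 hx'
    exact p.consistent y hy y' hy' (by simp only at h; omega)

theorem modification_underlying (p : SignedPartition) :
    p.modification.underlying = modify p.underlying := by
  simp [modification, underlying, modify, Multiset.filter_map]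

theorem completion_underlying (p : SignedPartition) :
    p.completion.underlying = complete p.underlying := by
  simp [completion, underlying, complete]

end SignedPartition

/-! ### Dual-irreducible polynomials -/

section Polynomials

variable {F : Type*} [Field F]

/-- The dual of `f = a₀ + a₁ t + ⋯ + t^d` with `a₀ ≠ 0`: the polynomial `∑ aᵢ a₀⁻¹ t^(d-i)`. -/
def dual (f : F[X]) : F[X] := C (f.coeff 0)⁻¹ * f.reverse

/-- A self-dual monic polynomial that is irreducible, or equal to `g * dual g` for an irreducible
monic polynomial `g ≠ t` that is not self-dual. -/
def IsDualIrreducible (f : F[X]) : Prop :=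
  f.Monic ∧ f.coeff 0 ≠ 0 ∧ dual f = f ∧
    (Irreducible f ∨
      ∃ g : F[X], g.Monic ∧ Irreducible g ∧ g.coeff 0 ≠ 0 ∧ dual g ≠ g ∧ f = g * dual g)

variable (F) in
/-- The set `Φˢ` of dual-irreducible polynomials. -/
abbrev DualIrreducible : Type _ := {f : F[X] // IsDualIrreducible f}

theorem isDualIrreducible_X_sub_C (ε : ℤˣ) : IsDualIrreducible (X - C ((ε : ℤ) : F)) := by
  have hc : (X - C ((ε : ℤ) : F)).coeff 0 = -((ε : ℤ) : F) := by simp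
  have hr : (X - C ((ε : ℤ) : F)).reverse = 1 - C ((ε : ℤ) : F) * X := by
    have hd : (X - C ((ε : ℤ) : F)).natDegree = 1 := natDegree_X_sub_C _
    ext k
    rw [coeff_reverse, hd]
    rcases k with _ | _ | k
    · rw [show revAt 1 0 = 1 from revAt_le (by norm_num), coeff_sub, coeff_sub, coeff_C]
      simp
    · rw [show revAt 1 (0 + 1) = 0 from revAt_le (by norm_num)]
      simp [coeff_one]
    · rw [revAt_eq_self_of_lt (by omega), coeff_sub, coeff_sub, coeff_C, coeff_C_mul]
      simp [coeff_X, coeff_one]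
  refine ⟨monic_X_sub_C _, ?_, ?_, Or.inl (irreducible_X_sub_C _)⟩
  · rw [hc]
    rcases Int.units_eq_one_or ε with rfl | rfl <;> simp
  · rw [dual, hc, hr]
    rcases Int.units_eq_one_or ε with rfl | rfl
    · simp
    · simp [add_comm]

/-- The polynomials `t - 1` (for `ε = 1`) and `t + 1` (for `ε = -1`) as elements of `Φˢ`. -/
def linear (ε : ℤˣ) : DualIrreducible F := ⟨X - C ((ε : ℤ) : F), isDualIrreducible_X_sub_C ε⟩

theorem linear_ne [NeZero (2 : F)] : (linear (-1) : DualIrreducible F) ≠ linear 1 := by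
  intro h
  have h1 := congrArg (fun f : DualIrreducible F => f.1.eval 1) h
  simp only [linear, eval_sub, eval_X, eval_C] at h1
  norm_num at h1
  exact two_ne_zero h1

end Polynomials

/-! ### Partition valued functions with signs -/

/-- A triple `(λ, h⁺, h⁻)` of a partition valued function `λ` on `Φˢ` with `λ(f) = ∅` for almost
all `f` and of signs for the parts of `λ(t+1)` and of `λ(t-1)`. -/
structure SignedFunction (F : Type*) [Field F] where
  part : DualIrreducible F →₀ Multiset ℕ
  pos : ∀ f, ∀ i ∈ part f, 0 < i
  signPlus : SignedPartition
  signMinus : SignedPartition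
  underlying_signPlus : signPlus.underlying = part (linear (-1))
  underlying_signMinus : signMinus.underlying = part (linear 1)

namespace SignedFunction

variable {F : Type*} [Field F]

/-- The weight `∑ deg f * |λ(f)|`, over all `f` in `Φˢ`. -/
def weight (σ : SignedFunction F) : ℕ :=
  σ.part.sum fun f p => f.1.natDegree * SymplecticNormalForm.weight p

/-- Symplectic partition valued functions. -/
def IsSymplectic (σ : SignedFunction F) : Prop :=
  σ.signPlus.IsSymplectic ∧ σ.signMinus.IsSymplectic

/-- Modification affects only the value at `t - 1`, with its signs. -/
def modification [NeZero (2 : F)] (σ : SignedFunction F) : SignedFunction F where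
  part := σ.part.update (linear 1) (modify (σ.part (linear 1)))
  pos := by
    classical
    intro f i hi
    rw [Finsupp.update_apply] at hi
    split_ifs at hi with h
    · obtain ⟨j, hj, rfl⟩ := Multiset.mem_map.1 hi
      have := (Multiset.mem_filter.1 hj).2
      omega
    · exact σ.pos f i hi
  signPlus := σ.signPlus
  signMinus := σ.signMinus.modification
  underlying_signPlus := by
    classical
    rw [Finsupp.update_apply, if_neg linear_ne, σ.underlying_signPlus]
  underlying_signMinus := by
    classical
    rw [Finsupp.update_apply, if_pos rfl, SignedPartition.modification_underlying,
      σ.underlying_signMinus]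

/-- Completion affects only the value at `t - 1`, with its signs. -/
def completion [NeZero (2 : F)] (σ : SignedFunction F) : SignedFunction F where
  part := σ.part.update (linear 1) (complete (σ.part (linear 1)))
  pos := by
    classical
    intro f i hi
    rw [Finsupp.update_apply] at hi
    split_ifs at hi with h
    · obtain ⟨j, hj, rfl⟩ := Multiset.mem_map.1 hi
      exact Nat.succ_pos _
    · exact σ.pos f i hi
  signPlus := σ.signPlus
  signMinus := σ.signMinus.completion
  underlying_signPlus := by
    classical
    rw [Finsupp.update_apply, if_neg linear_ne, σ.underlying_signPlus]
  underlying_signMinus := by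
    classical
    rw [Finsupp.update_apply, if_pos rfl, SignedPartition.completion_underlying,
      σ.underlying_signMinus]

end SignedFunction

/-! ### Symplectic groups and their block embeddings -/

/-- The symplectic group of the `2n`-dimensional symplectic space over `F` with the hyperbolic
basis `e_i = Sum.inl i`, `f_i = Sum.inr i`. -/
abbrev Sp (n : ℕ) (F : Type*) [Field F] : Type _ := Matrix.symplecticGroup (Fin n) F

section Groups

variable {F : Type*} [Field F] {n m : ℕ}

/-- Splits the basis `e_i, f_i` (`i < n`) into the vectors with `i < m` and those with `m ≤ i`. -/
def splitIndex (h : m ≤ n) :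
    Fin n ⊕ Fin n ≃ (Fin m ⊕ Fin m) ⊕ (Fin (n - m) ⊕ Fin (n - m)) :=
  let e : Fin n ≃ Fin m ⊕ Fin (n - m) :=
    (finCongr (Nat.add_sub_of_le h).symm).trans finSumFinEquiv.symm
  (Equiv.sumCongr e e).trans (Equiv.sumSumSumComm _ _ _ _)

/-- The block diagonal matrix `diag(U, 1)` of size `2n`, where `U` acts on the span of the
`e_i, f_i` with `i < m` and the identity matrix of size `2n - 2m` on the span of the others. -/
def blockMatrix (h : m ≤ n) (U : Matrix (Fin m ⊕ Fin m) (Fin m ⊕ Fin m) F) :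
    Matrix (Fin n ⊕ Fin n) (Fin n ⊕ Fin n) F :=
  (Matrix.fromBlocks U 0 0 1).submatrix (splitIndex h) (splitIndex h)

theorem blockMatrix_mul (h : m ≤ n) (U V : Matrix (Fin m ⊕ Fin m) (Fin m ⊕ Fin m) F) :
    blockMatrix h (U * V) = blockMatrix h U * blockMatrix h V := by
  simp [blockMatrix, Matrix.submatrix_mul_equiv, Matrix.fromBlocks_multiply]

theorem blockMatrix_one (h : m ≤ n) :
    blockMatrix h (1 : Matrix (Fin m ⊕ Fin m) (Fin m ⊕ Fin m) F) = 1 := by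
  simp [blockMatrix]

theorem J_eq_submatrix (h : m ≤ n) :
    Matrix.J (Fin n) F = (Matrix.fromBlocks (Matrix.J (Fin m) F) 0 0
      (Matrix.J (Fin (n - m)) F)).submatrix (splitIndex h) (splitIndex h) := by
  have key : (Matrix.J (Fin n) F).submatrix (splitIndex h).symm (splitIndex h).symm =
      Matrix.fromBlocks (Matrix.J (Fin m) F) 0 0 (Matrix.J (Fin (n - m)) F) := by
    ext i j
    rcases i with (i | i) | (i | i) <;> rcases j with (j | j) | (j | j) <;>
      simp [splitIndex, Matrix.J, Matrix.one_apply, Fin.ext_iff] <;> omega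
  rw [← key]
  simp

theorem blockMatrix_mem (h : m ≤ n) (U : Sp m F) :
    blockMatrix h U.1 ∈ Matrix.symplecticGroup (Fin n) F := by
  have hU := SymplecticGroup.mem_iff.1 U.2
  rw [SymplecticGroup.mem_iff, J_eq_submatrix h, blockMatrix, Matrix.transpose_submatrix,
    Matrix.submatrix_mul_equiv, Matrix.submatrix_mul_equiv, Matrix.fromBlocks_transpose,
    Matrix.fromBlocks_multiply, Matrix.fromBlocks_multiply]
  simp [hU]

/-- The embedding `U ↦ diag(U, 1)` of `Sp_m(q)` into `Sp_n(q)`, for `m ≤ n`. -/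
def embed (h : m ≤ n) : Sp m F →* Sp n F where
  toFun U := ⟨blockMatrix h U.1, blockMatrix_mem h U⟩
  map_one' := Subtype.ext (blockMatrix_one h)
  map_mul' U V := Subtype.ext (blockMatrix_mul h U.1 V.1)

/-- The vectors `e_i, f_i` of the smaller space, as vectors of the larger one. -/
def castIndex (h : m ≤ n) : Fin m ⊕ Fin m → Fin n ⊕ Fin n :=
  Sum.map (Fin.castLE h) (Fin.castLE h)

theorem splitIndex_castIndex (h : m ≤ n) (x : Fin m ⊕ Fin m) :
    splitIndex h (castIndex h x) = Sum.inl x := by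
  rw [← Equiv.eq_symm_apply]
  rcases x with x | x <;> simp [splitIndex, castIndex, Fin.ext_iff]

theorem exists_castIndex (h : m ≤ n) {i : Fin n ⊕ Fin n} {x : Fin m ⊕ Fin m}
    (hx : splitIndex h i = Sum.inl x) : i = castIndex h x :=
  (splitIndex h).injective (by rw [hx, splitIndex_castIndex])

theorem blockMatrix_castIndex (h : m ≤ n) (U : Matrix (Fin m ⊕ Fin m) (Fin m ⊕ Fin m) F)
    (x y : Fin m ⊕ Fin m) : blockMatrix h U (castIndex h x) (castIndex h y) = U x y := by
  simp [blockMatrix, splitIndex_castIndex]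

theorem blockMatrix_left (h : m ≤ n) (U : Matrix (Fin m ⊕ Fin m) (Fin m ⊕ Fin m) F)
    {i : Fin n ⊕ Fin n} (hi : ∀ x, i ≠ castIndex h x) (j : Fin n ⊕ Fin n) :
    blockMatrix h U i j = (1 : Matrix _ _ F) i j := by
  rw [← blockMatrix_one h]
  simp only [blockMatrix, Matrix.submatrix_apply]
  rcases hs : splitIndex h i with x | x
  · exact absurd (exists_castIndex h hs) (hi x)
  · rcases splitIndex h j with y | y <;> simp

theorem blockMatrix_right (h : m ≤ n) (U : Matrix (Fin m ⊕ Fin m) (Fin m ⊕ Fin m) F)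
    (i : Fin n ⊕ Fin n) {j : Fin n ⊕ Fin n} (hj : ∀ x, j ≠ castIndex h x) :
    blockMatrix h U i j = (1 : Matrix _ _ F) i j := by
  rw [← blockMatrix_one h]
  simp only [blockMatrix, Matrix.submatrix_apply]
  rcases hs : splitIndex h j with x | x
  · exact absurd (exists_castIndex h hs) (hj x)
  · rcases splitIndex h i with y | y <;> simp

theorem castIndex_injective (h : m ≤ n) : Function.Injective (castIndex h) := fun x y hxy =>
  Sum.inl_injective (by rw [← splitIndex_castIndex h, hxy, splitIndex_castIndex])

theorem castIndex_castIndex {k : ℕ} (h : m ≤ n) (h' : n ≤ k) (x : Fin m ⊕ Fin m) :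
    castIndex h' (castIndex h x) = castIndex (h.trans h') x := by
  rcases x with x | x <;> simp [castIndex]

theorem blockMatrix_blockMatrix {k : ℕ} (h : m ≤ n) (h' : n ≤ k)
    (U : Matrix (Fin m ⊕ Fin m) (Fin m ⊕ Fin m) F) :
    blockMatrix h' (blockMatrix h U) = blockMatrix (h.trans h') U := by
  have one_cast : ∀ i j : Fin n ⊕ Fin n, (1 : Matrix _ _ F) (castIndex h' i) (castIndex h' j) =
      (1 : Matrix _ _ F) i j := fun i j => by
    simp [Matrix.one_apply, (castIndex_injective h').eq_iff]
  ext i j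
  by_cases hi : ∃ x, i = castIndex h' x
  · obtain ⟨x, rfl⟩ := hi
    by_cases hj : ∃ y, j = castIndex h' y
    · obtain ⟨y, rfl⟩ := hj
      rw [blockMatrix_castIndex]
      by_cases hx : ∃ x', x = castIndex h x'
      · obtain ⟨x', rfl⟩ := hx
        by_cases hy : ∃ y', y = castIndex h y'
        · obtain ⟨y', rfl⟩ := hy
          rw [castIndex_castIndex, castIndex_castIndex, blockMatrix_castIndex,
            blockMatrix_castIndex]
        · push Not at hy
          rw [blockMatrix_right h U _ hy, blockMatrix_right, one_cast]
          intro z hz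
          rw [← castIndex_castIndex h h'] at hz
          exact hy z (castIndex_injective h' hz)
      · push Not at hx
        rw [blockMatrix_left h U hx, blockMatrix_left, one_cast]
        intro z hz
        rw [← castIndex_castIndex h h'] at hz
        exact hx z (castIndex_injective h' hz)
    · push Not at hj
      rw [blockMatrix_right h' _ _ hj, blockMatrix_right]
      intro z hz
      rw [← castIndex_castIndex h h'] at hz
      exact hj _ hz
  · push Not at hi
    rw [blockMatrix_left h' _ hi, blockMatrix_left]
    intro z hz
    rw [← castIndex_castIndex h h'] at hz
    exact hi _ hz

instance : DirectedSystem (fun n : ℕ => Sp n F) (fun _ _ h => embed (F := F) h) where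
  map_self n U := Subtype.ext <| by
    ext i j
    have hc : ∀ x : Fin n ⊕ Fin n, castIndex (le_refl n) x = x := by
      rintro (x | x) <;> simp [castIndex]
    have := blockMatrix_castIndex (le_refl n) U.1 i j
    rwa [hc, hc] at this
  map_map _ _ _ h h' U := Subtype.ext (blockMatrix_blockMatrix h h' U.1)

variable (F) in
/-- The infinite symplectic group: the direct limit of the groups `Sp_n(q)` along the embeddings
`U ↦ diag(U, 1)`. -/
abbrev SpInf : Type _ := DirectLimit (fun n : ℕ => Sp n F) (fun _ _ h => embed (F := F) h)

/-- The element of the infinite symplectic group given by `U ∈ Sp_n(q)`. -/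
def toInf (U : Sp n F) : SpInf F := ⟦⟨n, U⟩⟧

end Groups

/-! ### Wall forms -/

section Wall

variable {F : Type*} [Field F] {n : ℕ}

/-- A symplectic matrix as a linear map (acting on column vectors). -/
def act (U : Sp n F) : Module.End F (Fin n ⊕ Fin n → F) := Matrix.toLin' U.1

variable (F n) in
/-- The symplectic form `Q` with `Q(e_i, f_i) = 1 = -Q(f_i, e_i)`, and zero on all other pairs of
basis vectors. -/
def form : LinearMap.BilinForm F (Fin n ⊕ Fin n → F) := Matrix.toBilin' (-Matrix.J (Fin n) F)

/-- `U - ε`, for a sign `ε`. -/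
def shift (U : Sp n F) (ε : ℤˣ) : Module.End F (Fin n ⊕ Fin n → F) :=
  act U - ((ε : ℤ) : F) • 1

/-- `Δ = U - U⁻¹`. -/
def delta (U : Sp n F) : Module.End F (Fin n ⊕ Fin n → F) := act U - act U⁻¹

theorem form_swap (v w : Fin n ⊕ Fin n → F) : form F n v w = -form F n w v := by
  simp only [form, Matrix.toBilin'_apply']
  rw [Matrix.dotProduct_mulVec, ← Matrix.mulVec_transpose, dotProduct_comm]
  simp [Matrix.neg_mulVec]

theorem act_mul (U V : Sp n F) : act (U * V) = act U * act V := Matrix.toLin'_mul _ _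

theorem act_one : act (1 : Sp n F) = 1 := Matrix.toLin'_one

theorem form_act (U : Sp n F) (v w : Fin n ⊕ Fin n → F) :
    form F n (act U v) (act U w) = form F n v w := by
  have hU := SymplecticGroup.mem_iff'.1 U.2
  change (form F n).comp (Matrix.toLin' U.1) (Matrix.toLin' U.1) v w = _
  rw [form, Matrix.toBilin'_comp, Matrix.mul_neg, Matrix.neg_mul, hU]

theorem act_mul_act_inv (U : Sp n F) : act U * act U⁻¹ = 1 := by
  rw [← act_mul, mul_inv_cancel, act_one]

theorem act_inv_mul_act (U : Sp n F) : act U⁻¹ * act U = 1 := by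
  rw [← act_mul, inv_mul_cancel, act_one]

theorem form_act_left (U : Sp n F) (v w : Fin n ⊕ Fin n → F) :
    form F n (act U v) w = form F n v (act U⁻¹ w) := by
  conv_lhs => rw [show w = act U (act U⁻¹ w) by rw [← Module.End.mul_apply, act_mul_act_inv]; rfl]
  exact form_act U _ _

theorem form_delta (U : Sp n F) (v w : Fin n ⊕ Fin n → F) :
    form F n (delta U v) w = -form F n v (delta U w) := by
  have h := form_act_left U⁻¹ v w
  rw [inv_inv] at h
  simp [delta, form_act_left, h]

theorem form_delta_pow (U : Sp n F) (k : ℕ) (v w : Fin n ⊕ Fin n → F) :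
    form F n ((delta U ^ k) v) w = (-1) ^ k * form F n v ((delta U ^ k) w) := by
  induction k generalizing v w with
  | zero => simp
  | succ k ih =>
    rw [pow_succ', Module.End.mul_apply, form_delta, ih, ← Module.End.mul_apply, ← pow_succ,
      ← pow_succ']
    ring

theorem form_shift (U : Sp n F) (ε : ℤˣ) (v w : Fin n ⊕ Fin n → F) :
    form F n (shift U ε v) w = -((ε : ℤ) : F) * form F n v (act U⁻¹ (shift U ε w)) := by
  have h : act U⁻¹ (act U w) = w := by rw [← Module.End.mul_apply, act_inv_mul_act]; rfl
  rcases Int.units_eq_one_or ε with rfl | rfl <;>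
    simp [shift, form_act_left, h, add_comm]

theorem commute_act_inv_shift (U : Sp n F) (ε : ℤˣ) : Commute (act U⁻¹) (shift U ε) := by
  have : Commute (act U⁻¹) (act U) := by
    rw [Commute, SemiconjBy, act_inv_mul_act, act_mul_act_inv]
  exact this.sub_right ((Commute.one_right _).smul_right _)

/-- `Δ` is a multiple of `U - ε` in the commutative algebra generated by `U`. -/
theorem exists_delta_eq (U : Sp n F) (ε : ℤˣ) :
    ∃ c : Module.End F (Fin n ⊕ Fin n → F), Commute c (shift U ε) ∧ delta U = c * shift U ε := by
  refine ⟨1 + ((ε : ℤ) : F) • act U⁻¹, ?_, ?_⟩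
  · exact (Commute.one_left _).add_left ((commute_act_inv_shift U ε).smul_left _)
  · refine LinearMap.ext fun v => ?_
    have h : act U⁻¹ (act U v) = v := by rw [← Module.End.mul_apply, act_inv_mul_act]; rfl
    rcases Int.units_eq_one_or ε with rfl | rfl
    · simp [delta, shift, h]
    · simp [delta, shift, h]
      exact sub_eq_add_neg _ _

theorem delta_pow_apply (U : Sp n F) (ε : ℤˣ) (k : ℕ) {v : Fin n ⊕ Fin n → F}
    (hv : (shift U ε ^ k) v = 0) : (delta U ^ k) v = 0 := by
  obtain ⟨c, hc, h⟩ := exists_delta_eq U ε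
  rw [h, hc.mul_pow, Module.End.mul_apply, hv, map_zero]

theorem shift_delta_pow_apply (U : Sp n F) (ε : ℤˣ) (k : ℕ) {v : Fin n ⊕ Fin n → F}
    (hv : (shift U ε ^ (k + 1)) v = 0) : shift U ε ((delta U ^ k) v) = 0 := by
  obtain ⟨c, hc, h⟩ := exists_delta_eq U ε
  rw [h, hc.mul_pow, ← Module.End.mul_apply, ← mul_assoc, ← (hc.pow_left k).eq, mul_assoc,
    ← pow_succ', Module.End.mul_apply, hv, map_zero]

/-- `ker (U - ε)^i`. -/
def kerPow (U : Sp n F) (ε : ℤˣ) (i : ℕ) : Submodule F (Fin n ⊕ Fin n → F) :=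
  LinearMap.ker (shift U ε ^ i)

/-- The subspace `ker (U - ε)^(i-1) + (U - ε) ker (U - ε)^(i+1)` of `ker (U - ε)^i`. -/
def wallKernel (U : Sp n F) (ε : ℤˣ) (i : ℕ) : Submodule F (kerPow U ε i) :=
  (kerPow U ε (i - 1) ⊔ (kerPow U ε (i + 1)).map (shift U ε)).submoduleOf (kerPow U ε i)

/-- The bilinear form `(v, w) ↦ Q(Δ^(i-1) v, w)` on `ker (U - ε)^i`. -/
def preWallForm (U : Sp n F) (ε : ℤˣ) (i : ℕ) : LinearMap.BilinForm F (kerPow U ε i) :=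
  ((form F n).comp (delta U ^ (i - 1)) LinearMap.id).comp (kerPow U ε i).subtype
    (kerPow U ε i).subtype

theorem preWallForm_apply (U : Sp n F) (ε : ℤˣ) (i : ℕ) (v w : kerPow U ε i) :
    preWallForm U ε i v w = form F n ((delta U ^ (i - 1)) v.1) w.1 := rfl

theorem preWallForm_isRefl (U : Sp n F) (ε : ℤˣ) (i : ℕ) : (preWallForm U ε i).IsRefl := by
  intro v w h
  rw [preWallForm_apply, form_delta_pow, form_swap] at h
  rw [preWallForm_apply]
  simpa using h

theorem wallKernel_le (U : Sp n F) (ε : ℤˣ) (i : ℕ) :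
    wallKernel U ε i ≤ LinearMap.ker (preWallForm U ε i) := by
  intro v hv
  obtain ⟨a, ha, b, hb, hab⟩ := Submodule.mem_sup.1 (show v.1 ∈ _ from hv)
  obtain ⟨u, -, rfl⟩ := Submodule.mem_map.1 hb
  rw [LinearMap.mem_ker]
  ext w
  rw [preWallForm_apply, ← hab, map_add, map_add, LinearMap.add_apply,
    delta_pow_apply U ε (i - 1) (LinearMap.mem_ker.1 ha), form_delta_pow, form_shift]
  have hw : shift U ε ((delta U ^ (i - 1)) w.1) = 0 := by
    apply shift_delta_pow_apply
    have := LinearMap.mem_ker.1 w.2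
    rcases i with _ | i
    · simp only [pow_zero, Module.End.one_apply] at this
      rw [this, map_zero]
    · simpa using this
  simp [hw]

/-- The space `H_i` of the Wall form of `U` at the eigenvalue `ε = ±1`. If `W` is the `i`-th
summand of an orthogonal decomposition of the generalized `ε`-eigenspace of `U` into subspaces
that are free over `F[t]/(t - ε)^j`, `j = 1, 2, …`, then the inclusion of `W` into
`ker (U - ε)^i` induces an isomorphism of `W / (U - ε) W` onto this quotient. -/
abbrev WallSpace (U : Sp n F) (ε : ℤˣ) (i : ℕ) : Type _ := kerPow U ε i ⧸ wallKernel U ε i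

/-- The `i`-th Wall form `h_i([v], [w]) = Q(Δ^(i-1) v, w)`, for `i ≥ 1`. -/
def wallForm (U : Sp n F) (ε : ℤˣ) (i : ℕ) : LinearMap.BilinForm F (WallSpace U ε i) :=
  LinearMap.IsRefl.liftQ₂ (preWallForm U ε i) (wallKernel U ε i) (preWallForm_isRefl U ε i)
    (wallKernel_le U ε i)

open Classical in
/-- The sign of the `i`-th Wall form: `-1` for odd `i` (the form is then alternating), and for
even `i` (the form is then symmetric) the class of its discriminant in `Fˣ / (Fˣ)² = {±1}`. -/
def wallSign (U : Sp n F) (ε : ℤˣ) (i : ℕ) : ℤˣ :=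
  if Even i ∧
      IsSquare (LinearMap.BilinForm.toMatrix (Module.finBasis F (WallSpace U ε i)) (wallForm U ε i)).det
  then 1 else -1

end Wall

/-! ### Symplectic types -/

section Types

variable {F : Type*} [Field F] {n : ℕ}

open Classical in
/-- `V_U` is the module `V` over `F[t]` on which `t` acts as `U`. The partition valued function
`part` on `Φˢ` is that of `U` if `V_U = ⨁ F[t]/(f_j^(l_j))` for some finite family of pairs
`(f_j, l_j)`, and if the partition `part f` consists of the `l_j` with `f_j = f`, for all `f`. -/
def HasPartitionFunction (U : Sp n F) (part : DualIrreducible F → Multiset ℕ) : Prop :=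
  ∃ (r : ℕ) (f : Fin r → DualIrreducible F) (l : Fin r → ℕ),
    Nonempty (Module.AEval' (act U) ≃ₗ[F[X]]
      ⨁ j : Fin r, F[X] ⧸ Ideal.span {(f j).1 ^ l j}) ∧
    ∀ g, part g = (Finset.univ.val.filter fun j => f j = g).map l

/-- The symplectic function `σ` is the symplectic type of `U`. -/
def HasSymplecticType (U : Sp n F) (σ : SignedFunction F) : Prop :=
  σ.IsSymplectic ∧ HasPartitionFunction U σ.part ∧
    (∀ x ∈ σ.signPlus.parts, x.2 = wallSign U (-1) x.1) ∧
    ∀ x ∈ σ.signMinus.parts, x.2 = wallSign U 1 x.1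

/-- `lam` is the modified symplectic type of `U ∈ Sp_n(q)`. -/
def HasModifiedType [NeZero (2 : F)] (U : Sp n F) (lam : SignedFunction F) : Prop :=
  ∃ σ : SignedFunction F, HasSymplecticType U σ ∧ σ.modification = lam

/-- The conjugacy class of the infinite symplectic group given by a modified symplectic type. -/
def infClass [NeZero (2 : F)] (lam : SignedFunction F) : Set (SpInf F) :=
  {g | ∃ (n : ℕ) (U : Sp n F), toInf U = g ∧ HasModifiedType U lam}

/-- The fiber `Z(lam × mu : eta)`. -/
def fiber [NeZero (2 : F)] (lam mu eta : SignedFunction F) : Set (SpInf F × SpInf F) :=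
  {g | g.1 ∈ infClass lam ∧ g.2 ∈ infClass mu ∧ g.1 * g.2 ∈ infClass eta}

end Types

/-- The orbit of a pair under simultaneous conjugation. -/
def simultaneousOrbit {G : Type*} [Group G] (g : G × G) : Set (G × G) :=
  Set.range fun T : G => (T * g.1 * T⁻¹, T * g.2 * T⁻¹)

end SymplecticNormalForm

end

/-!
The proof is linear algebra on the symplectic space; the types enter only through ranks.

For `A = U - 1` the partition valued function of `U` determines the ranks of all powers of `A`,
because `A` acts on a summand `F[t]/(f^l)` bijectively unless `f = t - 1`. Consequently the weight of
the modified type is the rank of `A`, and the weight of its completion is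
`2 rank A - rank A^2 = dim (im A) + dim (im A ∩ ker A)` (`HasModifiedType.weight_eq`).

Given `U₁` and `U₂`, put `I = im (U₁ - 1) + im (U₂ - 1)`. Since `ker (U - 1) = im (U - 1)^⊥` for
symplectic `U` (`ker_act_sub_one`), the space of common fixed vectors is `I^⊥`. A complement `N` of
the radical `I ∩ I^⊥` in `I^⊥` is nondegenerate, so the whole space is the orthogonal sum of `N^⊥` and
`N`, both matrices fix `N` pointwise, and `dim N^⊥ = dim I + dim (I ∩ I^⊥)`. Hyperbolic bases
of `N^⊥` and `N` together form the columns of a symplectic matrix that conjugates `U₁` and `U₂` to the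
block form `diag(V, 1)` with `V` of size `dim N^⊥` (`exists_simultaneous_embed`).

If the weights are additive, then `im (U₁ U₂ - 1)` is contained in `I` and has at least its dimension,
hence equals `I`, and `dim I + dim (I ∩ I^⊥)` is the weight of the completed type of `U₁ U₂`. In
general `dim I` is at most the sum of the weights `‖lam‖` and `‖mu‖`, which do not depend on `n`; so
every pair in the fiber is conjugate in the infinite symplectic group to a pair in `Sp_m(q)` with
`m ≤ ‖lam‖ + ‖mu‖`, and there are finitely many of these.
-/

namespace SymplecticNormalForm

/-! ### Ranks and weights -/

section Rank

variable {F : Type*} [Field F]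

/-- The rank of an endomorphism that is diagonal with respect to a product decomposition. -/
theorem finrank_range_eq_sum {ι V : Type*} [Fintype ι] [AddCommGroup V] [Module F V]
    {N : ι → Type*} [∀ i, AddCommGroup (N i)] [∀ i, Module F (N i)]
    [∀ i, Module.Finite F (N i)] (e : V ≃ₗ[F] ∀ i, N i) (φ : Module.End F V)
    (T : ∀ i, Module.End F (N i)) (h : ∀ v i, e (φ v) i = T i (e v i)) :
    Module.finrank F (LinearMap.range φ) = ∑ i, Module.finrank F (LinearMap.range (T i)) := by
  let g : (∀ i, LinearMap.range (T i)) →ₗ[F] ∀ i, N i :=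
    LinearMap.pi fun i => (LinearMap.range (T i)).subtype ∘ₗ LinearMap.proj i
  have hg : Function.Injective g := fun x y hxy =>
    funext fun i => Subtype.ext (congrFun hxy i)
  have hr : (LinearMap.range φ).map (e : V →ₗ[F] ∀ i, N i) = LinearMap.range g := by
    ext w
    constructor
    · rintro ⟨_, ⟨v, rfl⟩, rfl⟩
      exact ⟨fun i => ⟨T i (e v i), e v i, rfl⟩, funext fun i => (h v i).symm⟩
    · rintro ⟨y, rfl⟩
      choose x hx using fun i => (y i).2
      refine ⟨φ (e.symm x), ⟨_, rfl⟩, funext fun i => ?_⟩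
      rw [LinearEquiv.coe_coe, h, e.apply_symm_apply, hx]
      rfl
  rw [← LinearEquiv.finrank_map_eq e, hr, LinearMap.finrank_range_of_inj hg,
    Module.finrank_pi_fintype]

theorem finrank_range_mulLeft_of_isCoprime {p q : F[X]} (h : IsCoprime p q) :
    Module.finrank F (LinearMap.range (LinearMap.mulLeft F
      (Ideal.Quotient.mk (Ideal.span {p}) q))) = p.natDegree := by
  obtain ⟨a, b, hab⟩ := h
  have hs : LinearMap.range (LinearMap.mulLeft F (Ideal.Quotient.mk (Ideal.span {p}) q)) = ⊤ := by
    rw [LinearMap.range_eq_top]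
    intro y
    refine ⟨Ideal.Quotient.mk _ b * y, ?_⟩
    have h1 : Ideal.Quotient.mk (Ideal.span {p}) (b * q) = 1 := by
      rw [← (Ideal.Quotient.mk (Ideal.span {p})).map_one, Ideal.Quotient.mk_eq_mk_iff_sub_mem,
        Ideal.mem_span_singleton]
      exact ⟨-a, by linear_combination hab⟩
    rw [LinearMap.mulLeft_apply, ← mul_assoc, ← map_mul, mul_comm q, h1, one_mul]
  rw [hs, finrank_top, finrank_quotient_span_eq_natDegree]

theorem finrank_range_mulLeft_pow {p : F[X]} (hp : p ≠ 0) (k l : ℕ) :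
    Module.finrank F (LinearMap.range (LinearMap.mulLeft F
      (Ideal.Quotient.mk (Ideal.span {p ^ l}) (p ^ k)))) = (l - k) * p.natDegree := by
  set I := Ideal.span {p ^ l}
  -- multiplication by `p ^ k`, lifted to a map on all polynomials
  let f : F[X] →ₗ[F] F[X] ⧸ I :=
    LinearMap.mulLeft F (Ideal.Quotient.mk I (p ^ k)) ∘ₗ (Ideal.Quotient.mkₐ F I).toLinearMap
  have hf : LinearMap.range f =
      LinearMap.range (LinearMap.mulLeft F (Ideal.Quotient.mk I (p ^ k))) :=
    LinearMap.range_comp_of_range_eq_top _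
      (LinearMap.range_eq_top.2 (Ideal.Quotient.mkₐ_surjective F I))
  have hk : LinearMap.ker f = (Ideal.span {p ^ (l - k)}).restrictScalars F := by
    ext r
    rw [LinearMap.mem_ker, Submodule.restrictScalars_mem, Ideal.mem_span_singleton]
    change Ideal.Quotient.mk I (p ^ k) * Ideal.Quotient.mk I r = 0 ↔ _
    rw [← map_mul, Ideal.Quotient.eq_zero_iff_mem, Ideal.mem_span_singleton]
    rcases le_total k l with h | h
    · obtain ⟨d, rfl⟩ := Nat.exists_eq_add_of_le h
      rw [Nat.add_sub_cancel_left, pow_add, mul_dvd_mul_iff_left (pow_ne_zero _ hp)]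
    · rw [Nat.sub_eq_zero_of_le h, pow_zero]
      exact iff_of_true ((pow_dvd_pow p h).mul_right r) (one_dvd _)
  rw [← hf, ← LinearEquiv.finrank_eq f.quotKerEquivRange, hk, ← natDegree_pow]
  exact finrank_quotient_span_eq_natDegree

/-- `t - 1` is the only dual-irreducible polynomial with the root `1`: the factors of `g * dual g`
both have the root `1` or neither has. -/
theorem IsDualIrreducible.eq_X_sub_C_one_of_isRoot {f : F[X]} (hf : IsDualIrreducible f)
    (h : f.IsRoot 1) : f = X - C 1 := by
  have key : ∀ g : F[X], g.Monic → Irreducible g → g.IsRoot 1 → g = X - C 1 := by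
    intro g hg hi h1
    refine (eq_of_monic_of_associated (monic_X_sub_C 1) hg ?_).symm
    exact (irreducible_X_sub_C 1).associated_of_dvd hi (dvd_iff_isRoot.2 h1)
  obtain ⟨hm, -, -, hi | ⟨g, hgm, hgi, hg0, hgd, rfl⟩⟩ := hf
  · exact key f hm hi h
  · have h1 : g.IsRoot 1 := by
      rw [IsRoot, eval_mul, mul_eq_zero] at h
      refine h.elim id fun h => ?_
      rw [dual, eval_mul, eval_C, mul_eq_zero] at h
      refine h.elim (fun h => absurd h (inv_ne_zero hg0)) fun h => ?_
      let := invertibleOne (α := F)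
      have := eval₂_reverse_eq_zero_iff (RingHom.id F) (1 : F) g
      rw [invOf_one] at this
      exact this.1 h
    have hd := (isDualIrreducible_X_sub_C (F := F) 1).2.2.1
    rw [Units.val_one, Int.cast_one, ← key g hgm hgi h1] at hd
    exact absurd hd hgd

theorem DualIrreducible.isCoprime_of_ne (f : DualIrreducible F) (h : f ≠ linear 1) (k l : ℕ) :
    IsCoprime (f.1 ^ l) ((X - C 1) ^ k) := by
  refine IsCoprime.pow (IsCoprime.symm ?_)
  rw [(irreducible_X_sub_C (1 : F)).coprime_iff_not_dvd, dvd_iff_isRoot]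
  intro hr
  exact h (Subtype.ext (by simpa [linear] using f.2.eq_X_sub_C_one_of_isRoot hr))

open Classical in
/-- The rank of `(U - 1)^k` for `U` acting as multiplication by `t` on `⨁ F[t]/(f_j^(l_j))`. -/
theorem finrank_range_sub_one_pow {V : Type*} [AddCommGroup V] [Module F V] (φ : Module.End F V)
    {r : ℕ} (f : Fin r → DualIrreducible F) (l : Fin r → ℕ)
    (e : Module.AEval' φ ≃ₗ[F[X]] ⨁ j : Fin r, F[X] ⧸ Ideal.span {(f j).1 ^ l j}) (k : ℕ) :
    Module.finrank F (LinearMap.range ((φ - 1) ^ k)) =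
      ∑ j, if f j = linear 1 then l j - k else (f j).1.natDegree * l j := by
  let e' : V ≃ₗ[F] ∀ j : Fin r, F[X] ⧸ Ideal.span {(f j).1 ^ l j} :=
    (Module.AEval'.of φ).trans ((e.restrictScalars F).trans
      (DirectSum.linearEquivFunOnFintype F (Fin r)
        fun j => F[X] ⧸ Ideal.span {(f j).1 ^ l j}))
  have hfin : ∀ j, Module.Finite F (F[X] ⧸ Ideal.span {(f j).1 ^ l j}) := fun j =>
    ((f j).2.1.pow (l j)).finite_quotient
  have h1 : ∀ v, Module.AEval'.of φ ((φ - 1) v) = (X - C 1 : F[X]) • Module.AEval'.of φ v := by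
    intro v
    rw [sub_smul, Module.AEval'.X_smul_of, map_one, one_smul, ← map_sub]
    rfl
  have h2 : ∀ v, Module.AEval'.of φ (((φ - 1) ^ k) v) =
      ((X - C 1 : F[X]) ^ k) • Module.AEval'.of φ v := by
    intro v
    induction k with
    | zero => simp
    | succ k ih => rw [pow_succ', Module.End.mul_apply, h1, ih, pow_succ', mul_smul]
  rw [finrank_range_eq_sum e' _ (fun j => LinearMap.mulLeft F
    (Ideal.Quotient.mk (Ideal.span {(f j).1 ^ l j}) ((X - C 1) ^ k)))]
  · refine Finset.sum_congr rfl fun j _ => ?_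
    split_ifs with hj
    · have : (f j).1 = X - C 1 := by rw [hj]; simp [linear]
      rw [this, finrank_range_mulLeft_pow (X_sub_C_ne_zero 1), natDegree_X_sub_C, mul_one]
    · rw [finrank_range_mulLeft_of_isCoprime ((f j).isCoprime_of_ne hj k _),
        natDegree_pow, mul_comm]
  · intro v j
    change (e (Module.AEval'.of φ (((φ - 1) ^ k) v))) j = _
    rw [h2, map_smul]
    rfl

theorem finsupp_sum_eq_sum_of_fiberwise {α M : Type*} [DecidableEq α] [Zero M] {r : ℕ} (f : Fin r → α)
    (c : Fin r → ℕ) (p : α →₀ M) (w : α → M → ℕ) (hw : ∀ a, w a 0 = 0)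
    (h : ∀ a, w a (p a) = ∑ j with f j = a, c j) : p.sum w = ∑ j, c j := by
  classical
  rw [Finsupp.sum_of_support_subset p (s := p.support ∪ Finset.univ.image f)
    Finset.subset_union_left w (fun a _ => hw a), Finset.sum_congr rfl fun a _ => h a]
  exact Finset.sum_fiberwise_of_maps_to (fun j _ => Finset.mem_union_right _
    (Finset.mem_image_of_mem f (Finset.mem_univ j))) c

theorem weight_modify (p : Multiset ℕ) : weight (modify p) = (p.map (· - 1)).sum := by
  induction p using Multiset.induction with
  | empty => rfl
  | cons a p ih =>
    rw [Multiset.map_cons, Multiset.sum_cons, ← ih]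
    by_cases h : 1 < a
    · simp [weight, modify, h]
    · simp [weight, modify, h]
      omega

theorem weight_complete_modify (p : Multiset ℕ) :
    weight (complete (modify p)) = (p.map fun i => if 1 < i then i else 0).sum := by
  induction p using Multiset.induction with
  | empty => rfl
  | cons a p ih =>
    rw [Multiset.map_cons, Multiset.sum_cons, ← ih]
    by_cases h : 1 < a
    · simp [weight, modify, complete, h]
      omega
    · simp [weight, modify, complete, h]

variable [NeZero (2 : F)] {n : ℕ} {U : Sp n F} {lam : SignedFunction F}

open Classical in
/-- The ranks of `U - 1` and of `(U - 1)^2` determine the weights of the modified type and of its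
completion: a summand `F[t]/((t-1)^l)` contributes `l - 1` to the rank and to the weight, and `l`
(for `l ≥ 2`) to the weight of the completion. -/
theorem HasModifiedType.weight_eq (h : HasModifiedType U lam) :
    Module.finrank F (LinearMap.range (act U - 1)) = lam.weight ∧
      lam.completion.weight + Module.finrank F (LinearMap.range ((act U - 1) ^ 2)) =
        2 * lam.weight := by
  obtain ⟨σ, ⟨-, ⟨r, f, l, ⟨e⟩, hp⟩, -⟩, rfl⟩ := h
  have hdeg : (linear 1 : DualIrreducible F).1.natDegree = 1 := natDegree_X_sub_C _
  -- the values of `σ` at a polynomial other than `t - 1` enter both weights unchanged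
  have hother : ∀ a, a ≠ linear 1 → ∀ c : Fin r → ℕ,
      a.1.natDegree * weight (σ.part a) = ∑ j with f j = a,
        if f j = linear 1 then c j else (f j).1.natDegree * l j := by
    intro a ha c
    trans ∑ j with f j = a, a.1.natDegree * l j
    · rw [← Finset.mul_sum, hp]
      rfl
    · refine Finset.sum_congr rfl fun j hj => ?_
      rw [(Finset.mem_filter.1 hj).2, if_neg ha]
  have hlin : ∀ c : ℕ → ℕ, ((σ.part (linear 1)).map c).sum = ∑ j with f j = linear 1,
      if f j = linear 1 then c (l j) else (f j).1.natDegree * l j := by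
    intro c
    trans ∑ j with f j = linear 1, c (l j)
    · rw [hp, Multiset.map_map]
      rfl
    · exact Finset.sum_congr rfl fun j hj => by rw [if_pos (Finset.mem_filter.1 hj).2]
  have h1 : σ.modification.weight =
      ∑ j, if f j = linear 1 then l j - 1 else (f j).1.natDegree * l j := by
    refine finsupp_sum_eq_sum_of_fiberwise f _ _ _ (fun a => by simp [weight]) fun a => ?_
    rw [SignedFunction.modification, Finsupp.update_apply]
    split_ifs with ha
    · rw [ha, hdeg, one_mul, weight_modify, hlin (· - 1)]
    · exact hother a ha _
  have h2 : σ.modification.completion.weight =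
      ∑ j, if f j = linear 1 then (if 1 < l j then l j else 0)
        else (f j).1.natDegree * l j := by
    refine finsupp_sum_eq_sum_of_fiberwise f _ _ _ (fun a => by simp [weight]) fun a => ?_
    rw [SignedFunction.completion, Finsupp.update_apply, SignedFunction.modification,
      Finsupp.update_apply, Finsupp.update_apply, if_pos rfl]
    split_ifs with ha
    · rw [ha, hdeg, one_mul, weight_complete_modify, hlin fun i => if 1 < i then i else 0]
    · exact hother a ha _
  have e1 := finrank_range_sub_one_pow (act U) f l e 1
  rw [pow_one] at e1
  refine ⟨e1.trans h1.symm, ?_⟩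
  rw [h1, h2, finrank_range_sub_one_pow (act U) f l e 2, ← Finset.sum_add_distrib, Finset.mul_sum]
  refine Finset.sum_congr rfl fun j _ => ?_
  split_ifs <;> omega

end Rank

/-! ### Subspaces with an alternating form -/

section Alternating

variable {F V : Type*} [Field F] [AddCommGroup V] [Module F V] [FiniteDimensional F V]
  {B : LinearMap.BilinForm F V}

/-- A complement of the radical `K ∩ K^⊥` in a subspace `K` is nondegenerate. -/
theorem exists_nondegenerate_le (hB : B.IsRefl) (K : Submodule F V) :
    ∃ N ≤ K, Disjoint N (B.orthogonal N) ∧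
      Module.finrank F N + Module.finrank F (K ⊓ B.orthogonal K : Submodule F V) =
        Module.finrank F K := by
  obtain ⟨C, hC⟩ := Submodule.exists_isCompl (K ⊓ B.orthogonal K)
  have hsup : K ⊓ C ⊔ K ⊓ B.orthogonal K = K := by
    rw [inf_sup_assoc_of_le C inf_le_left, sup_comm, hC.sup_eq_top, inf_top_eq]
  have hinf : (K ⊓ C) ⊓ (K ⊓ B.orthogonal K) = ⊥ := by
    rw [eq_bot_iff, ← hC.inf_eq_bot, inf_comm]
    exact inf_le_inf_left _ inf_le_right
  refine ⟨K ⊓ C, inf_le_left, ?_, ?_⟩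
  · rw [Submodule.disjoint_def]
    intro x hx hx'
    have hxK : x ∈ B.orthogonal K := by
      intro y hy
      rw [← hsup] at hy
      obtain ⟨a, ha, b, hb, rfl⟩ := Submodule.mem_sup.1 hy
      have h1 : B a x = 0 := hx' a ha
      have h2 : B b x = 0 := hB _ _ (hb.2 x hx.1)
      change B (a + b) x = 0
      rw [map_add, LinearMap.add_apply, h1, h2, add_zero]
    have : x ∈ (K ⊓ C) ⊓ (K ⊓ B.orthogonal K) := ⟨hx, hx.1, hxK⟩
    rwa [hinf, Submodule.mem_bot] at this
  · have := Submodule.finrank_sup_add_finrank_inf_eq (K ⊓ C) (K ⊓ B.orthogonal K)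
    rw [hsup, hinf, finrank_bot] at this
    omega

/-- A subspace on which an alternating form is nondegenerate has a hyperbolic basis. -/
theorem exists_hyperbolic_family (hB : B.IsAlt) (d : ℕ) :
    ∀ W : Submodule F V, Module.finrank F W = d → Disjoint W (B.orthogonal W) →
      ∃ (k : ℕ) (e f : Fin k → V), d = 2 * k ∧ (∀ i, e i ∈ W) ∧ (∀ i, f i ∈ W) ∧
        (∀ i j, B (e i) (e j) = 0) ∧ (∀ i j, B (f i) (f j) = 0) ∧
        ∀ i j, B (e i) (f j) = if i = j then 1 else 0 := by
  induction d using Nat.strong_induction_on with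
  | _ d ih =>
  intro W hW hdis
  rcases Nat.eq_zero_or_pos d with rfl | hd
  · exact ⟨0, Fin.elim0, Fin.elim0, rfl, fun i => i.elim0, fun i => i.elim0, fun i => i.elim0,
      fun i => i.elim0, fun i => i.elim0⟩
  have hWne : W ≠ ⊥ := by
    rintro rfl
    rw [finrank_bot] at hW
    omega
  obtain ⟨x, hxW, hx0⟩ := Submodule.exists_mem_ne_zero_of_ne_bot hWne
  obtain ⟨y, hyW, hxy⟩ : ∃ y ∈ W, B x y = 1 := by
    by_contra! hcon
    refine hx0 (Submodule.disjoint_def.1 hdis x hxW fun y hy => ?_)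
    by_contra hne
    refine hcon ((B x y)⁻¹ • y) (W.smul_mem _ hy) ?_
    rw [map_smul, smul_eq_mul, inv_mul_cancel₀]
    exact fun h => hne (hB.isRefl _ _ h)
  have hyx : B y x = -1 := by rw [← hB.neg_eq, hxy]
  -- the plane spanned by `x` and `y` is split off
  let φ : W →ₗ[F] F × F := ((B x).comp W.subtype).prod ((B y).comp W.subtype)
  have hφ : Function.Surjective φ := by
    rintro ⟨a, b⟩
    refine ⟨a • ⟨y, hyW⟩ - b • ⟨x, hxW⟩, ?_⟩
    simp [φ, hxy, hyx, hB.self_eq_zero]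
  have hfin := φ.finrank_range_add_finrank_ker
  rw [LinearMap.range_eq_top.2 hφ, finrank_top, Module.finrank_prod, Module.finrank_self,
    hW] at hfin
  set W' : Submodule F V := (LinearMap.ker φ).map W.subtype with hW'
  have hmem : ∀ w, w ∈ W' ↔ w ∈ W ∧ B x w = 0 ∧ B y w = 0 := by
    intro w
    simp only [hW', φ, Submodule.mem_map, LinearMap.mem_ker]
    simp
    tauto
  have hdW' : Module.finrank F W' = d - 2 := by
    rw [hW', Submodule.finrank_map_subtype_eq]
    omega
  have hdis' : Disjoint W' (B.orthogonal W') := by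
    rw [Submodule.disjoint_def]
    intro w hw hw'
    obtain ⟨hwW, hxw, hyw⟩ := (hmem w).1 hw
    refine Submodule.disjoint_def.1 hdis w hwW fun u hu => ?_
    have hu' : u - B x u • y + B y u • x ∈ W' := by
      refine (hmem _).2 ⟨W.add_mem (W.sub_mem hu (W.smul_mem _ hyW)) (W.smul_mem _ hxW), ?_, ?_⟩
      · simp [hxy, hB.self_eq_zero]
      · simp [hyx, hB.self_eq_zero]
    have h0 := hw' _ hu'
    change B (u - B x u • y + B y u • x) w = 0 at h0
    change B u w = 0
    simpa [hxw, hyw] using h0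
  obtain ⟨k, e, f, hk, he, hf, hee, hff, hef⟩ := ih (d - 2) (by omega) W' hdW' hdis'
  have hex : ∀ i, B x (e i) = 0 := fun i => ((hmem _).1 (he i)).2.1
  have hey : ∀ i, B y (e i) = 0 := fun i => ((hmem _).1 (he i)).2.2
  have hfx : ∀ i, B x (f i) = 0 := fun i => ((hmem _).1 (hf i)).2.1
  have hfy : ∀ i, B y (f i) = 0 := fun i => ((hmem _).1 (hf i)).2.2
  have hex' : ∀ i, B (e i) x = 0 := fun i => hB.isRefl _ _ (hex i)
  have hey' : ∀ i, B (e i) y = 0 := fun i => hB.isRefl _ _ (hey i)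
  have hfy' : ∀ i, B (f i) y = 0 := fun i => hB.isRefl _ _ (hfy i)
  refine ⟨k + 1, Fin.cons x e, Fin.cons y f, by omega, ?_, ?_, ?_, ?_, ?_⟩
  · exact Fin.cases hxW fun i => ((hmem _).1 (he i)).1
  · exact Fin.cases hyW fun i => ((hmem _).1 (hf i)).1
  · refine Fin.cases (Fin.cases ?_ fun j => ?_) fun i => Fin.cases ?_ fun j => ?_ <;>
      simp [hB.self_eq_zero, hex, hex', hee]
  · refine Fin.cases (Fin.cases ?_ fun j => ?_) fun i => Fin.cases ?_ fun j => ?_ <;>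
      simp [hB.self_eq_zero, hfy, hfy', hff]
  · refine Fin.cases (Fin.cases ?_ fun j => ?_) fun i => Fin.cases ?_ fun j => ?_ <;>
      simp [hxy, hfx, hey', hef, Fin.succ_ne_zero, (Fin.succ_ne_zero _).symm]

end Alternating

/-! ### Pairs of symplectic matrices and their common fixed space -/

section Symplectic

variable {F : Type*} [Field F] {n m : ℕ}

theorem form_isAlt [NeZero (2 : F)] : (form F n).IsAlt := by
  intro v
  have h := form_swap v v
  have h2 : (2 : F) * form F n v v = 0 := by linear_combination h
  exact (mul_eq_zero.1 h2).resolve_left two_ne_zero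

theorem form_isRefl : (form F n).IsRefl := fun v w h => by rw [form_swap, h, neg_zero]

theorem form_nondegenerate : (form F n).Nondegenerate := by
  refine Matrix.Nondegenerate.toBilin' (Matrix.nondegenerate_of_det_ne_zero ?_)
  rw [Matrix.det_neg]
  exact mul_ne_zero (pow_ne_zero _ (neg_ne_zero.2 one_ne_zero)) (Matrix.isUnit_det_J _ _).ne_zero

theorem ker_act_sub_one (U : Sp n F) :
    LinearMap.ker (act U - 1) = (form F n).orthogonal (LinearMap.range (act U - 1)) := by
  have hinv : ∀ v, act U (act U⁻¹ v) = v := fun v => by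
    rw [← Module.End.mul_apply, act_mul_act_inv]; rfl
  have hinv' : ∀ v, act U⁻¹ (act U v) = v := fun v => by
    rw [← Module.End.mul_apply, act_inv_mul_act]; rfl
  have key : ∀ w v, form F n ((act U - 1) w) v = form F n w (act U⁻¹ v - v) := by
    intro w v
    simp [form_act_left]
  ext v
  constructor
  · rintro hv _ ⟨w, rfl⟩
    have hv' : act U v = v := sub_eq_zero.1 hv
    change form F n ((act U - 1) w) v = 0
    rw [key]
    nth_rw 1 [← hv']
    rw [hinv', sub_self, map_zero]
  · intro hv
    have h0 : act U⁻¹ v - v = 0 :=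
      form_nondegenerate.2 _ fun w => (key w v).symm.trans (hv _ ⟨w, rfl⟩)
    refine sub_eq_zero.2 (?_ : act U v = v)
    nth_rw 1 [← sub_eq_zero.1 h0]
    exact hinv v

/-- A symplectic matrix fixing the `e_i, f_i` with `m ≤ i` is block diagonal. -/
theorem exists_eq_embed (h : m ≤ n) (M : Sp n F)
    (hM : ∀ y, act M (Pi.single ((splitIndex h).symm (Sum.inr y)) 1) =
      Pi.single ((splitIndex h).symm (Sum.inr y)) 1) : ∃ V : Sp m F, M = embed h V := by
  set s := splitIndex h with hs
  set N := M.1.submatrix s.symm s.symm with hN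
  have hcol : ∀ i y, N i (Sum.inr y) =
      (1 : Matrix ((Fin m ⊕ Fin m) ⊕ (Fin (n - m) ⊕ Fin (n - m)))
        ((Fin m ⊕ Fin m) ⊕ (Fin (n - m) ⊕ Fin (n - m))) F) i (Sum.inr y) := by
    intro i y
    have := congrFun (hM y) (s.symm i)
    rw [act, Matrix.toLin'_apply, Matrix.mulVec_single_one] at this
    rw [hN, Matrix.submatrix_apply]
    refine this.trans ?_
    simp [Matrix.one_apply, Pi.single_apply]
  have hb : N = Matrix.fromBlocks N.toBlocks₁₁ 0 N.toBlocks₂₁ 1 := by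
    ext i j
    rcases j with j | j
    · rcases i with i | i <;> rfl
    · rw [hcol]
      rcases i with i | i <;> simp [Matrix.one_apply]
  have hJ := J_eq_submatrix (F := F) h
  have hsymp := SymplecticGroup.mem_iff'.1 M.2
  have hMN : M.1 = N.submatrix s s := by simp [hN]
  rw [hJ, hMN, ← hs, Matrix.transpose_submatrix, Matrix.submatrix_mul_equiv,
    Matrix.submatrix_mul_equiv, hb, Matrix.fromBlocks_transpose, Matrix.fromBlocks_multiply,
    Matrix.fromBlocks_multiply] at hsymp
  have hsymp' := congrArg (fun A => A.submatrix s.symm s.symm) hsymp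
  simp only [Matrix.submatrix_submatrix, Equiv.self_comp_symm, Matrix.submatrix_id_id] at hsymp'
  obtain ⟨h11, -, h21, -⟩ := Matrix.fromBlocks_inj.1 hsymp'
  have h0 : N.toBlocks₂₁ = 0 := by
    have : Matrix.J (Fin (n - m)) F * (Matrix.J (Fin (n - m)) F * N.toBlocks₂₁) = 0 := by
      simp only [Matrix.transpose_zero, Matrix.zero_mul, Matrix.transpose_one, Matrix.one_mul,
        Matrix.mul_zero, zero_add] at h21
      rw [h21, Matrix.mul_zero]
    rw [← Matrix.mul_assoc, Matrix.J_squared] at this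
    simpa using this
  refine ⟨⟨N.toBlocks₁₁, SymplecticGroup.mem_iff'.2 ?_⟩, Subtype.ext ?_⟩
  · simpa [h0] using h11
  · change M.1 = (Matrix.fromBlocks N.toBlocks₁₁ 0 0 1).submatrix s s
    rw [hMN]
    nth_rw 1 [hb]
    rw [h0]

/-- A hyperbolic basis adapted to a nondegenerate subspace: it consists of the columns of a
symplectic matrix, and those with index at least `m` lie in the subspace. -/
theorem exists_adapted_basis [NeZero (2 : F)] (N : Submodule F (Fin n ⊕ Fin n → F))
    (hN : Disjoint N ((form F n).orthogonal N)) :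
    ∃ (m : ℕ) (h : m ≤ n) (S : Sp n F), Module.finrank F N + 2 * m = 2 * n ∧
      ∀ y, act S (Pi.single ((splitIndex h).symm (Sum.inr y)) 1) ∈ N := by
  have hN' : Disjoint ((form F n).orthogonal N)
      ((form F n).orthogonal ((form F n).orthogonal N)) := by
    rw [LinearMap.BilinForm.orthogonal_orthogonal form_nondegenerate form_isRefl]
    exact hN.symm
  obtain ⟨m, e, f, hm, he, hf, hee, hff, hef⟩ := exists_hyperbolic_family form_isAlt _ _ rfl hN'
  obtain ⟨k, e', f', hk, he', hf', hee', hff', hef'⟩ :=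
    exists_hyperbolic_family form_isAlt _ _ rfl hN
  have hdim := LinearMap.BilinForm.finrank_orthogonal (form_nondegenerate (F := F) (n := n)) N
  have hle := N.finrank_le
  have hV : Module.finrank F (Fin n ⊕ Fin n → F) = 2 * n := by simp [two_mul]
  rw [hV] at hdim hle
  have h : m ≤ n := by omega
  obtain rfl : k = n - m := by omega
  let v : (Fin m ⊕ Fin m) ⊕ (Fin (n - m) ⊕ Fin (n - m)) → Fin n ⊕ Fin n → F :=
    Sum.elim (Sum.elim e f) (Sum.elim e' f')
  let S : Matrix (Fin n ⊕ Fin n) (Fin n ⊕ Fin n) F :=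
    Matrix.of fun i j => v (splitIndex h j) i
  have hcross : ∀ x ∈ (form F n).orthogonal N, ∀ y ∈ N,
      form F n x y = 0 ∧ form F n y x = 0 := fun x hx y hy =>
    ⟨form_isRefl _ _ (hx y hy), hx y hy⟩
  have hgram : ∀ i j, form F n (v i) (v j) =
      -Matrix.fromBlocks (Matrix.J (Fin m) F) 0 0 (Matrix.J (Fin (n - m)) F) i j := by
    rintro ((i | i) | (i | i)) ((j | j) | (j | j))
    · simp [v, Matrix.J, hee]
    · simp [v, Matrix.J, hef, Matrix.one_apply]
    · simp [v, (hcross _ (he i) _ (he' j)).1]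
    · simp [v, (hcross _ (he i) _ (hf' j)).1]
    · rw [form_swap]; simp [v, Matrix.J, hef, Matrix.one_apply, eq_comm]
    · simp [v, Matrix.J, hff]
    · simp [v, (hcross _ (hf i) _ (he' j)).1]
    · simp [v, (hcross _ (hf i) _ (hf' j)).1]
    · simp [v, (hcross _ (he j) _ (he' i)).2]
    · simp [v, (hcross _ (hf j) _ (he' i)).2]
    · simp [v, Matrix.J, hee']
    · simp [v, Matrix.J, hef', Matrix.one_apply]
    · simp [v, (hcross _ (he j) _ (hf' i)).2]
    · simp [v, (hcross _ (hf j) _ (hf' i)).2]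
    · rw [form_swap]; simp [v, Matrix.J, hef', Matrix.one_apply, eq_comm]
    · simp [v, Matrix.J, hff']
  have hS : S ∈ Matrix.symplecticGroup (Fin n) F := by
    rw [SymplecticGroup.mem_iff']
    have hcomp := Matrix.toBilin'_comp (-Matrix.J (Fin n) F) S S
    ext i j
    have h1 := LinearMap.congr_fun₂ hcomp (Pi.single i 1) (Pi.single j 1)
    rw [Matrix.toBilin'_single, LinearMap.BilinForm.comp_apply, Matrix.toLin'_apply,
      Matrix.toLin'_apply, Matrix.mulVec_single_one, Matrix.mulVec_single_one] at h1
    have h2 := hgram (splitIndex h i) (splitIndex h j)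
    rw [Matrix.mul_neg, Matrix.neg_mul, Matrix.neg_apply] at h1
    rw [J_eq_submatrix h, Matrix.submatrix_apply, ← neg_inj, ← h2, ← J_eq_submatrix h]
    exact h1.symm
  refine ⟨m, h, ⟨S, hS⟩, by omega, fun y => ?_⟩
  have hcol : act ⟨S, hS⟩ (Pi.single ((splitIndex h).symm (Sum.inr y)) 1) = v (Sum.inr y) := by
    rw [act, Matrix.toLin'_apply, Matrix.mulVec_single_one]
    ext i
    simp [S, Matrix.col]
  rw [hcol]
  rcases y with y | y
  · exact he' y
  · exact hf' y

/-- Two symplectic matrices are simultaneously conjugate to `diag(V₁, 1)` and `diag(V₂, 1)`, where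
`V₁` and `V₂` have the size `dim I + dim (I ∩ I^⊥)` for `I = im (U₁ - 1) + im (U₂ - 1)`. -/
theorem exists_simultaneous_embed [NeZero (2 : F)] (U₁ U₂ : Sp n F)
    (I : Submodule F (Fin n ⊕ Fin n → F))
    (hI : I = LinearMap.range (act U₁ - 1) ⊔ LinearMap.range (act U₂ - 1)) :
    ∃ (m : ℕ) (h : m ≤ n) (T : Sp n F) (V₁ V₂ : Sp m F),
      2 * m = Module.finrank F I +
        Module.finrank F (I ⊓ (form F n).orthogonal I : Submodule F (Fin n ⊕ Fin n → F)) ∧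
      T * U₁ * T⁻¹ = embed h V₁ ∧ T * U₂ * T⁻¹ = embed h V₂ := by
  obtain ⟨N, hNK, hdis, hfin⟩ := exists_nondegenerate_le form_isRefl ((form F n).orthogonal I)
  rw [LinearMap.BilinForm.orthogonal_orthogonal form_nondegenerate form_isRefl, inf_comm] at hfin
  have hdim := LinearMap.BilinForm.finrank_orthogonal (form_nondegenerate (F := F) (n := n)) I
  have hle := I.finrank_le
  have hV : Module.finrank F (Fin n ⊕ Fin n → F) = 2 * n := by simp [two_mul]
  rw [hV] at hdim hle
  obtain ⟨m, h, S, hm, hS⟩ := exists_adapted_basis N hdis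
  have hconj : ∀ U : Sp n F, LinearMap.range (act U - 1) ≤ I →
      ∃ V : Sp m F, S⁻¹ * U * S = embed h V := by
    intro U hU
    refine exists_eq_embed h _ fun y => ?_
    have hfix : act S (Pi.single ((splitIndex h).symm (Sum.inr y)) 1) ∈
        LinearMap.ker (act U - 1) := by
      rw [ker_act_sub_one]
      exact LinearMap.BilinForm.orthogonal_le hU (hNK (hS y))
    have hfix' := sub_eq_zero.1 (LinearMap.mem_ker.1 hfix)
    rw [Module.End.one_apply] at hfix'
    rw [act_mul, act_mul, Module.End.mul_apply, Module.End.mul_apply, hfix',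
      ← Module.End.mul_apply, act_inv_mul_act, Module.End.one_apply]
  obtain ⟨V₁, hV₁⟩ := hconj U₁ (hI ▸ le_sup_left)
  obtain ⟨V₂, hV₂⟩ := hconj U₂ (hI ▸ le_sup_right)
  refine ⟨m, h, S⁻¹, V₁, V₂, by omega, ?_, ?_⟩
  · rw [inv_inv, hV₁]
  · rw [inv_inv, hV₂]

/-- If the rank of `U - 1` is additive on `U₁` and `U₂`, then
`im (U₁ U₂ - 1) = im (U₁ - 1) + im (U₂ - 1)`. -/
theorem range_act_mul_sub_one (U₁ U₂ : Sp n F)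
    (h : Module.finrank F (LinearMap.range (act (U₁ * U₂) - 1)) =
      Module.finrank F (LinearMap.range (act U₁ - 1)) +
        Module.finrank F (LinearMap.range (act U₂ - 1))) :
    LinearMap.range (act (U₁ * U₂) - 1) =
      LinearMap.range (act U₁ - 1) ⊔ LinearMap.range (act U₂ - 1) := by
  have hle : LinearMap.range (act (U₁ * U₂) - 1) ≤
      LinearMap.range (act U₁ - 1) ⊔ LinearMap.range (act U₂ - 1) := by
    rintro _ ⟨v, rfl⟩
    have : (act (U₁ * U₂) - 1) v = (act U₁ - 1) (act U₂ v) + (act U₂ - 1) v := by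
      simp [act_mul]
    rw [this]
    exact Submodule.add_mem_sup ⟨_, rfl⟩ ⟨_, rfl⟩
  refine Submodule.eq_of_le_of_finrank_le hle ?_
  rw [h]
  exact Submodule.finrank_add_le_finrank_add_finrank _ _

theorem finrank_range_act_embed_sub_one_le (h : m ≤ n) (U : Sp m F) :
    Module.finrank F (LinearMap.range (act (embed h U) - 1)) ≤
      Module.finrank F (LinearMap.range (act U - 1)) := by
  have hr : ∀ {k : ℕ} (W : Sp k F), Module.finrank F (LinearMap.range (act W - 1)) =
      (W.1 - 1).rank := by
    intro k W
    rw [Matrix.rank, act, ← Matrix.toLin'_apply', map_sub, Matrix.toLin'_one]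
    rfl
  rw [hr, hr]
  let P : Matrix ((Fin m ⊕ Fin m) ⊕ (Fin (n - m) ⊕ Fin (n - m))) (Fin m ⊕ Fin m) F :=
    Matrix.fromRows 1 0
  let Q : Matrix (Fin m ⊕ Fin m) ((Fin m ⊕ Fin m) ⊕ (Fin (n - m) ⊕ Fin (n - m))) F :=
    Matrix.fromCols 1 0
  have hPQ : P * (U.1 - 1) * Q = Matrix.fromBlocks (U.1 - 1) 0 0 0 := by
    simp only [P, Q, Matrix.fromRows_mul, Matrix.one_mul, Matrix.zero_mul, Matrix.mul_fromCols,
      Matrix.mul_one, Matrix.mul_zero]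
    ext (i | i) (j | j) <;> simp
  have : (embed h U).1 - 1 = (P * (U.1 - 1) * Q).submatrix (splitIndex h) (splitIndex h) := by
    change blockMatrix h U.1 - 1 = _
    rw [← blockMatrix_one h, hPQ]
    ext i j
    simp only [blockMatrix, Matrix.sub_apply, Matrix.submatrix_apply]
    rcases splitIndex h i with x | x <;> rcases splitIndex h j with y | y <;> simp
  rw [this, Matrix.rank_submatrix]
  exact (Matrix.rank_mul_le_left _ _).trans (Matrix.rank_mul_le_right _ _)

/-- The dimension of the radical of `im A`, for `A = U - 1`, from the ranks of `A` and `A^2`. -/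
theorem finrank_range_inf_orthogonal (U : Sp n F) :
    Module.finrank F (LinearMap.range ((act U - 1) ^ 2)) +
      Module.finrank F (LinearMap.range (act U - 1) ⊓
        (form F n).orthogonal (LinearMap.range (act U - 1)) : Submodule F (Fin n ⊕ Fin n → F)) =
      Module.finrank F (LinearMap.range (act U - 1)) := by
  rw [← ker_act_sub_one]
  set A := act U - 1
  have h := (A.domRestrict (LinearMap.range A)).finrank_range_add_finrank_ker
  rw [LinearMap.range_domRestrict, ← LinearMap.range_comp, LinearMap.ker_domRestrict,
    ← Submodule.finrank_map_subtype_eq, Submodule.map_comap_subtype] at h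
  rw [pow_two]
  exact h

end Symplectic

/-! ### The infinite symplectic group -/

section Infinite

variable {F : Type*} [Field F] {n m : ℕ}

theorem toInf_embed (h : m ≤ n) (U : Sp m F) : toInf (embed h U) = toInf U :=
  DirectLimit.mk_apply (F := fun n => Sp n F) (f := fun _ _ h => embed (F := F) h) m n U h

theorem toInf_conj (T U : Sp n F) : toInf (T * U * T⁻¹) = toInf T * toInf U * (toInf T)⁻¹ := by
  simp only [toInf, DirectLimit.inv_def, DirectLimit.mul_def]

theorem simultaneousOrbit_conj {G : Type*} [Group G] (T a b : G) :
    simultaneousOrbit (T * a * T⁻¹, T * b * T⁻¹) = simultaneousOrbit (a, b) := by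
  ext x
  constructor
  · rintro ⟨S, rfl⟩
    exact ⟨S * T, by simp [mul_assoc]⟩
  · rintro ⟨S, rfl⟩
    exact ⟨S * T⁻¹, by simp [mul_assoc]⟩

end Infinite

/-! ### Normal forms -/

theorem exists_simultaneous_embed_of_weight_eq {F : Type*} [Field F] [NeZero (2 : F)]
    {n m : ℕ} {U₁ U₂ : Sp n F} {lam mu eta : SignedFunction F}
    (h₁ : HasModifiedType U₁ lam) (h₂ : HasModifiedType U₂ mu)
    (h₁₂ : HasModifiedType (U₁ * U₂) eta) (hw : eta.weight = lam.weight + mu.weight)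
    (hm : eta.completion.weight = 2 * m) :
    ∃ (h : m ≤ n) (T : Sp n F) (V₁ V₂ : Sp m F),
      T * U₁ * T⁻¹ = embed h V₁ ∧ T * U₂ * T⁻¹ = embed h V₂ := by
  obtain ⟨e₁, -⟩ := h₁.weight_eq
  obtain ⟨e₂, -⟩ := h₂.weight_eq
  obtain ⟨e, e'⟩ := h₁₂.weight_eq
  have hI := range_act_mul_sub_one U₁ U₂ (by rw [e, e₁, e₂, hw])
  obtain ⟨k, h, T, V₁, V₂, hk, hV⟩ := exists_simultaneous_embed U₁ U₂ _ hI
  have hr := finrank_range_inf_orthogonal (U₁ * U₂)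
  obtain rfl : k = m := by omega
  exact ⟨h, T, V₁, V₂, hV⟩

/-- Any pair in the fiber is conjugate to a pair of matrices of size at most `2 (‖lam‖ + ‖mu‖)`. -/
theorem finite_image_simultaneousOrbit_fiber {F : Type*} [Field F] [Finite F] [NeZero (2 : F)]
    (lam mu eta : SignedFunction F) : (simultaneousOrbit '' fiber lam mu eta).Finite := by
  let S : Set (Set (SpInf F × SpInf F)) := ⋃ m ∈ Set.Iic (lam.weight + mu.weight),
    Set.range fun V : Sp m F × Sp m F => simultaneousOrbit (toInf V.1, toInf V.2)
  have hS : S.Finite := (Set.finite_Iic _).biUnion fun m _ => Set.finite_range _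
  refine hS.subset ?_
  rintro _ ⟨⟨g₁, g₂⟩, ⟨⟨n₁, U₁, rfl, h₁⟩, ⟨n₂, U₂, rfl, h₂⟩, -⟩, rfl⟩
  set n := max n₁ n₂
  have hn₁ : n₁ ≤ n := le_max_left _ _
  have hn₂ : n₂ ≤ n := le_max_right _ _
  obtain ⟨m, h, T, V₁, V₂, hm, hV₁, hV₂⟩ :=
    exists_simultaneous_embed (embed hn₁ U₁) (embed hn₂ U₂) _ rfl
  have hr₁ := finrank_range_act_embed_sub_one_le hn₁ U₁
  have hr₂ := finrank_range_act_embed_sub_one_le hn₂ U₂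
  rw [h₁.weight_eq.1] at hr₁
  rw [h₂.weight_eq.1] at hr₂
  have hI := Submodule.finrank_add_le_finrank_add_finrank
    (LinearMap.range (act (embed hn₁ U₁) - 1)) (LinearMap.range (act (embed hn₂ U₂) - 1))
  have hR := Submodule.finrank_mono (inf_le_left : _ ⊓ (form F n).orthogonal
    (LinearMap.range (act (embed hn₁ U₁) - 1) ⊔ LinearMap.range (act (embed hn₂ U₂) - 1)) ≤
      LinearMap.range (act (embed hn₁ U₁) - 1) ⊔ LinearMap.range (act (embed hn₂ U₂) - 1))
  have hm' : m ≤ lam.weight + mu.weight := by omega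
  refine Set.mem_biUnion (Set.mem_Iic.2 hm') ⟨(V₁, V₂), ?_⟩
  change simultaneousOrbit (toInf V₁, toInf V₂) = simultaneousOrbit (toInf U₁, toInf U₂)
  rw [← toInf_embed h V₁, ← toInf_embed h V₂, ← hV₁, ← hV₂, toInf_conj, toInf_conj,
    simultaneousOrbit_conj, toInf_embed, toInf_embed]

end SymplecticNormalForm

theorem mainTheorem3 (F : Type*) [Field F] [Finite F] [NeZero (2 : F)] :
    (∀ (n m : ℕ) (U₁ U₂ : SymplecticNormalForm.Sp n F)
        (lam mu eta : SymplecticNormalForm.SignedFunction F),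
      SymplecticNormalForm.HasModifiedType U₁ lam →
      SymplecticNormalForm.HasModifiedType U₂ mu →
      SymplecticNormalForm.HasModifiedType (U₁ * U₂) eta →
      eta.weight = lam.weight + mu.weight →
      eta.completion.weight = 2 * m →
      ∃ (h : m ≤ n) (T : SymplecticNormalForm.Sp n F) (V₁ V₂ : SymplecticNormalForm.Sp m F),
        T * U₁ * T⁻¹ = SymplecticNormalForm.embed h V₁ ∧
        T * U₂ * T⁻¹ = SymplecticNormalForm.embed h V₂ ∧
        T * (U₁ * U₂) * T⁻¹ = SymplecticNormalForm.embed h (V₁ * V₂)) ∧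
    (∀ lam mu eta : SymplecticNormalForm.SignedFunction F,
      (SymplecticNormalForm.simultaneousOrbit ''
        SymplecticNormalForm.fiber lam mu eta).Finite) := by
  refine ⟨fun n m U₁ U₂ lam mu eta h₁ h₂ h₁₂ hw hm => ?_,
    SymplecticNormalForm.finite_image_simultaneousOrbit_fiber⟩
  obtain ⟨h, T, V₁, V₂, hV₁, hV₂⟩ :=
    SymplecticNormalForm.exists_simultaneous_embed_of_weight_eq h₁ h₂ h₁₂ hw hm
  refine ⟨h, T, V₁, V₂, hV₁, hV₂, ?_⟩
  rw [map_mul, ← hV₁, ← hV₂]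
  group
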